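/- **Setting.** Let $A$ be a finite set and $Q$ a real matrix indexed by $A$. Call $Q$ *acceptable* if every (complex) eigenvalue of the matrix with entries $|Q(x,y)|$ has modulus strictly less than $1$. A rooted loop of positive length is a path $\omega=[\omega_0,\dots,\omega_n]$ in $A$ with $n=|\omega|\ge 1$ and $\omega_0=\omega_n$; let $\mathcal L$ be the set of these. Put $Q(\omega)=\prod_{j=1}^n Q(\omega_{j-1},\omega_j)$, $m(\omega)=Q(\omega)/|\omega|$ (a possibly signed measure, the loop measure) and $N^\omega(x)=\#\{1\le j\le n:\omega_j=x\}$. For $t\ge 0$ the loop soup at time $t$ gives to each finite multiset of loops $\ell\in\mathbb N^{\mathcal L}_{\rm fin}$ the (possibly negative) mass $$\lambda_t(\ell)=\prod_{\omega\in\mathcal L}e^{-t\,m(\omega)}\frac{(t\,m(\omega))^{\ell(\omega)}}{\ell(\omega)!},$$ and $L_\ell(x)=\sum_{\omega}\ell(\omega)N^\omega(x)$. For $s\in[0,\infty)^A$ let $Y(s)=(Y^x(s_x))_{x\in A}$, where the $Y^x$ are independent standard gamma processes, so that the $Y^x(s_x)$ are independent and $\mathrm{Gamma}(s_x,1)$-distributed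 (and $Y^x(0)=0$). The continuous occupation field is the signed measure $$\nu_t(V)=\sum_{\ell\in\mathbb N^{\mathcal L}_{\rm fin}}\lambda_t(\ell)\,\mathbb P\{Y(L_\ell)\in V\},$$ the field of trivial loops $\nu_t^{\rm triv}$ is the law of $|A|$ independent $\mathrm{Gamma}(t,1)$ variables indexed by $A$, and $\rho_t=\nu_t*\nu_t^{\rm triv}$. **Theorem.** Let $Q$ be a real, symmetric, acceptable matrix. Then $I-Q$ is invertible and $G=(I-Q)^{-1}$ is positive definite; $\sum_{\omega\in\mathcal L}|m(\omega)|<\infty$, the products defining $\lambda_{1/2}(\ell)$ converge unconditionally, and $\sum_{\ell}|\lambda_{1/2}(\ell)|<\infty$, so that $\rho_{1/2}$ is a well-defined finite signed measure. If $\varphi=(\varphi(x))_{x\in A}$ is the discrete Gaussian free field with covariance matrix $G$, i.e. a centred Gaussian vector with $\mathbb E[\varphi(x)\varphi(y)]=G(x,y)$, then the distribution of $\tfrac12\varphi^2=(\tfrac12\varphi(x)^2)_{x\in A}$ is $\rho_{1/2}$. -/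

import Mathlib

open MeasureTheory ProbabilityTheory
open scoped NNReal

namespace LoopSoup

/-! ### Weights and rooted loops -/

section Loops

/-- A real weight matrix is acceptable if every (complex) eigenvalue of the matrix of absolute
values `|Q x y|` lies in the open unit disc. -/
def Acceptable {A : Type*} [Fintype A] [DecidableEq A] (Q : Matrix A A ℝ) : Prop :=
  ∀ z ∈ spectrum ℂ (Q.map fun q => ((|q| : ℝ) : ℂ)), ‖z‖ < 1

/-- The Green's function `G = (I - Q)⁻¹`. -/
noncomputable def green {A : Type*} [Fintype A] [DecidableEq A] (Q : Matrix A A ℝ) :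
    Matrix A A ℝ :=
  (1 - Q)⁻¹

/-- A rooted loop of positive length: a path `[ω₀, …, ωₙ]` with `n > 0` and `ω₀ = ωₙ`. -/
structure RootedLoop (A : Type*) where
  /-- the number of steps -/
  len : ℕ
  /-- the vertices `ω₀, …, ωₙ` -/
  vertex : Fin (len + 1) → A
  len_pos : 0 < len
  closed : vertex 0 = vertex (Fin.last len)

/-- The path weight `Q(ω) = ∏ⱼ Q(ωⱼ₋₁, ωⱼ)`. -/
def pathWeight {A : Type*} (Q : Matrix A A ℝ) (ω : RootedLoop A) : ℝ :=
  ∏ j : Fin ω.len, Q (ω.vertex j.castSucc) (ω.vertex j.succ)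

/-- The rooted loop measure `m(ω) = Q(ω) / |ω|`. -/
noncomputable def loopMeasure {A : Type*} (Q : Matrix A A ℝ) (ω : RootedLoop A) : ℝ :=
  pathWeight Q ω / ω.len

/-- The number of visits of `ω` to `x`, counted among `ω₁, …, ωₙ`. -/
def visits {A : Type*} [DecidableEq A] (ω : RootedLoop A) (x : A) : ℕ :=
  (Finset.univ.filter fun j : Fin ω.len => ω.vertex j.succ = x).card

end Loops

/-! ### The loop soup -/

section Soup

/-- The point masses `e^{-r} r^k / k!` of the Poisson "distribution" with real (possibly negative)
parameter `r`. -/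
noncomputable def signedPoisson (r : ℝ) (k : ℕ) : ℝ :=
  Real.exp (-r) * r ^ k / (k.factorial : ℝ)

/-- The rooted loop soup at time `t`: the mass that the product of the signed Poisson measures
with parameters `t m(ω)` gives to a finite multiset `ℓ` of rooted loops, in which the loop `ω`
appears `ℓ ω` times. -/
noncomputable def soupWeight {A : Type*} (Q : Matrix A A ℝ) (t : ℝ≥0)
    (ℓ : RootedLoop A →₀ ℕ) : ℝ :=
  ∏' ω, signedPoisson (t * loopMeasure Q ω) (ℓ ω)

/-- The discrete local time `L_ℓ(x) = ∑_ω ℓ(ω) N^ω(x)` of a finite multiset of loops. -/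
def localTime {A : Type*} [DecidableEq A] (ℓ : RootedLoop A →₀ ℕ) (x : A) : ℕ :=
  ℓ.sum fun ω k => k * visits ω x

end Soup

/-! ### Gamma fields -/

section Gamma

/-- The law at time `s` of a standard gamma process: `Gamma(s, 1)`, which is the point mass at `0`
for `s = 0`. -/
noncomputable def gammaLaw (s : ℝ≥0) : Measure ℝ :=
  if s = 0 then Measure.dirac 0 else gammaMeasure s 1

instance isProbabilityMeasure_gammaLaw (s : ℝ≥0) : IsProbabilityMeasure (gammaLaw s) := by
  unfold gammaLaw
  split_ifs with h
  · infer_instance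
  · exact isProbabilityMeasure_gammaMeasure (NNReal.coe_pos.2 (pos_iff_ne_zero.2 h)) one_pos

/-- The law of `Y(s) = (Y^x(s_x))_{x ∈ A}`, for independent standard gamma processes `Y^x`. -/
noncomputable def gammaFieldLaw {A : Type*} [Fintype A] (s : A → ℝ≥0) : Measure (A → ℝ) :=
  Measure.pi fun x => gammaLaw (s x)

instance isProbabilityMeasure_gammaFieldLaw {A : Type*} [Fintype A] (s : A → ℝ≥0) :
    IsProbabilityMeasure (gammaFieldLaw s) := by
  unfold gammaFieldLaw
  infer_instance

end Gamma

/-! ### Signed mixtures and convolution -/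

section SignedMeasures

theorem hasSum_mixture {ι E : Type*} [MeasurableSpace E] {w : ι → ℝ} (hw : Summable w)
    (κ : ι → Measure E) [∀ i, IsProbabilityMeasure (κ i)] {f : ℕ → Set E}
    (hf : ∀ n, MeasurableSet (f n)) (hd : Pairwise (Function.onFun Disjoint f)) :
    HasSum (fun n => ∑' i, w i * (κ i).real (f n)) (∑' i, w i * (κ i).real (⋃ n, f n)) := by
  have h1 : ∀ i, HasSum (fun n => (κ i).real (f n)) ((κ i).real (⋃ n, f n)) := by
    intro i
    have h := (κ i).toSignedMeasure.m_iUnion hf hd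
    simpa [Measure.toSignedMeasure_apply_measurable, hf, MeasurableSet.iUnion hf] using h
  have hnorm : Summable fun p : ι × ℕ => |w p.1 * (κ p.1).real (f p.2)| := by
    rw [summable_prod_of_nonneg (fun _ => abs_nonneg _)]
    have e : ∀ i n, |w i * (κ i).real (f n)| = |w i| * (κ i).real (f n) := fun i n => by
      rw [abs_mul, abs_of_nonneg measureReal_nonneg]
    simp only [e]
    refine ⟨fun i => ((h1 i).mul_left _).summable, ?_⟩
    refine Summable.of_nonneg_of_le (fun i => ?_) (fun i => ?_) hw.abs
    · exact tsum_nonneg fun n => mul_nonneg (abs_nonneg _) measureReal_nonneg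
    · rw [((h1 i).mul_left _).tsum_eq]
      exact mul_le_of_le_one_right (abs_nonneg _) measureReal_le_one
  have hs : Summable fun p : ι × ℕ => w p.1 * (κ p.1).real (f p.2) := hnorm.of_abs
  have e2 : ∑' i, w i * (κ i).real (⋃ n, f n) = ∑' p : ι × ℕ, w p.1 * (κ p.1).real (f p.2) := by
    rw [hs.tsum_prod]
    exact tsum_congr fun i => ((h1 i).mul_left _).tsum_eq.symm
  rw [e2]
  have hs' := hs.hasSum
  rw [← (Equiv.prodComm ℕ ι).hasSum_iff] at hs'
  exact hs'.prod_fiberwise fun n =>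
    (((Equiv.prodComm ℕ ι).summable_iff.2 hs).prod_factor n).hasSum

open scoped Classical in
/-- The signed measure `V ↦ ∑ᵢ wᵢ κᵢ(V)`, for probability measures `κᵢ` and absolutely summable
real weights `wᵢ` (and the zero measure if the weights are not summable). -/
noncomputable def signedMixture {ι E : Type*} [MeasurableSpace E] (w : ι → ℝ)
    (κ : ι → Measure E) [∀ i, IsProbabilityMeasure (κ i)] : SignedMeasure E :=
  if hw : Summable w then
    { measureOf' := fun V => if MeasurableSet V then ∑' i, w i * (κ i).real V else 0
      empty' := by simp
      not_measurable' := fun _ hV => if_neg hV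
      m_iUnion' := fun f hf hd => by
        simpa [hf, MeasurableSet.iUnion hf] using hasSum_mixture hw κ hf hd }
  else 0

/-- Convolution of signed measures: the image of the product measure under addition. -/
noncomputable def signedConv {E : Type*} [MeasurableSpace E] [Add E] (μ ν : SignedMeasure E) :
    SignedMeasure E :=
  (μ.prod ν (ContinuousLinearMap.mul ℝ ℝ)).map fun p : E × E => p.1 + p.2

end SignedMeasures

/-! ### Occupation fields -/

section Occupation

/-- The continuous occupation field `ν_t(V) = ∑_ℓ λ_t(ℓ) ℙ{Y(L_ℓ) ∈ V}` of the loop soup. -/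
noncomputable def occupationField {A : Type*} [Fintype A] [DecidableEq A] (Q : Matrix A A ℝ)
    (t : ℝ≥0) : SignedMeasure (A → ℝ) :=
  signedMixture (soupWeight Q t) fun ℓ => gammaFieldLaw fun x => (localTime ℓ x : ℝ≥0)

/-- The law of the occupation field of the trivial loops: independent `Gamma(t, 1)` variables. -/
noncomputable def trivialField (A : Type*) [Fintype A] (t : ℝ≥0) : Measure (A → ℝ) :=
  gammaFieldLaw fun _ => t

instance isProbabilityMeasure_trivialField (A : Type*) [Fintype A] (t : ℝ≥0) :
    IsProbabilityMeasure (trivialField A t) := by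
  unfold trivialField
  infer_instance

/-- `ρ_t`, the convolution of the continuous occupation field with the field of trivial loops. -/
noncomputable def fullOccupationField {A : Type*} [Fintype A] [DecidableEq A] (Q : Matrix A A ℝ)
    (t : ℝ≥0) : SignedMeasure (A → ℝ) :=
  signedConv (occupationField Q t) (trivialField A t).toSignedMeasure

/-- `φ` is a centred discrete Gaussian free field on `A` with covariance matrix `G`: it is a
centred Gaussian vector with `𝔼[φ(x) φ(y)] = G x y`. -/
def IsGaussianFreeField {A Ω : Type*} [Fintype A] [DecidableEq A] [MeasurableSpace Ω]
    (P : Measure Ω) (G : Matrix A A ℝ) (φ : Ω → A → ℝ) : Prop :=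
  HasLaw (fun ω => WithLp.toLp 2 (φ ω)) (multivariateGaussian 0 G) P

end Occupation

end LoopSoup

/-!
The proof compares Laplace transforms. For `u ∈ [0, ∞)^A` both `½ φ²` and `ρ_{1/2}` have the
transform `(det (1 - Q) / det (1 - Q + u))^{1/2}`, where `u` also denotes the diagonal matrix.

*Gaussian side.* Write `φ = √G Z` with `Z` a standard Gaussian vector. Diagonalising `√G u √G` and
using the rotation invariance of `Z` gives `det (1 + u G)^{-1/2}`
(`laplace_map_sq_freeField`).

*Loop side.* With `d = (1 + u)⁻¹`, the Laplace transform of `Y(L_ℓ)` is `∏ₓ d(x)^{L_ℓ(x)}`, and the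
exponential formula over finite multisets (`hasSum_finsuppProd`) turns the sum over `ℓ` into
`exp (t ∑_ω m(ω) (∏ₓ d(x)^{N^ω(x)} - 1))`. The weights `m(ω) ∏ₓ d(x)^{N^ω(x)}` are the loop measure
of the symmetric matrix `√d Q √d` (`loopMeasure_sqrt_conj`), and the loop measure of a symmetric
matrix `S` with eigenvalues in `(-1, 1)` has total mass
`∑ₙ tr (Sⁿ) / n = -log det (1 - S)` (`hasSum_loopMeasure`). Convolving with the trivial loops
multiplies by `det(d)^{1/2}`, and `det (1 - √d Q √d) = det(d) det (1 - Q + u)`. All convergence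
questions reduce to the matrix `|Q|`, which dominates both `Q` and `√d Q √d`, and for which
`1 - |Q|` is positive definite (`Acceptable.posDef_one_sub_abs`).

*Uniqueness.* The functions `exp (-⟨u, ·⟩)` span an algebra that separates the points of the
orthant, so that a finite measure on the orthant is determined by its Laplace transform (`ext_of_laplace`).
A signed mixture is reduced to this case by moving its negative part to the other side
(`toSignedMeasure_eq_signedMixture`), and the convolution with the trivial field is taken inside
the mixture (`signedConv_signedMixture`).
-/

namespace LoopSoup

/-! ### Matrices dominated by an acceptable matrix -/

section Matrices

open Matrix

variable {A : Type*} [Fintype A] [DecidableEq A]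

/-- Acceptability bounds the modulus of every eigenvalue of `|Q|`; only the consequence that the
eigenvalues of `1 - |Q|` are positive is needed afterwards. -/
lemma Acceptable.posDef_one_sub_abs {Q : Matrix A A ℝ} (hacc : Acceptable Q) (hQ : Q.IsSymm) :
    (1 - Q.map (fun q => |q|)).PosDef := by
  have hP : (1 - Q.map (fun q => |q|)).IsHermitian := by
    ext i j
    simp [Matrix.one_apply, hQ.apply i j, eq_comm]
  rw [hP.posDef_iff_eigenvalues_pos]
  intro i
  have h1 : 1 - hP.eigenvalues i ∈ spectrum ℝ (Q.map (fun q => |q|)) := by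
    have h := hP.eigenvalues_mem_spectrum_real i
    rw [spectrum.mem_iff] at h ⊢
    rw [← IsUnit.neg_iff] at h
    convert! h using 2
    rw [map_sub, map_one]
    abel
  have h2 : ((1 - hP.eigenvalues i : ℝ) : ℂ) ∈
      spectrum ℂ (Q.map fun q => ((|q| : ℝ) : ℂ)) := by
    rw [Matrix.mem_spectrum_iff_isRoot_charpoly] at h1 ⊢
    have : (Q.map fun q => ((|q| : ℝ) : ℂ)) = (Q.map (fun q => |q|)).map Complex.ofRealHom := by
      ext; simp
    rw [this, Matrix.charpoly_map]
    exact h1.map (f := Complex.ofRealHom)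
  have h3 := hacc _ h2
  rw [Complex.norm_real, Real.norm_eq_abs, abs_lt] at h3
  linarith

/-- If `|S x y| ≤ P x y` entrywise, then `⟨v, S v⟩ ≤ ⟨|v|, P |v|⟩` for every vector `v`, so that
`1 - S` inherits positivity from `1 - P`. -/
lemma posDef_one_sub_of_abs_le {P S : Matrix A A ℝ} (hP : (1 - P).PosDef) (hS : S.IsSymm)
    (hSP : ∀ x y, |S x y| ≤ P x y) : (1 - S).PosDef := by
  refine .of_dotProduct_mulVec_pos ?_ fun v hv => ?_
  · ext i j
    simp [Matrix.one_apply, hS.apply i j, eq_comm]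
  · have hv' : (fun x => |v x|) ≠ 0 := fun h => hv <| by
      ext x
      simpa using congrFun h x
    refine (hP.dotProduct_mulVec_pos hv').trans_le ?_
    simp only [sub_mulVec, one_mulVec, dotProduct_sub, star_trivial]
    refine sub_le_sub (le_of_eq ?_) ?_
    · simp [dotProduct]
    · simp only [dotProduct, mulVec, Finset.mul_sum]
      refine Finset.sum_le_sum fun x _ => Finset.sum_le_sum fun y _ => ?_
      calc v x * (S x y * v y) ≤ |v x * (S x y * v y)| := le_abs_self _
        _ = |v x| * (|S x y| * |v y|) := by rw [abs_mul, abs_mul]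
        _ ≤ _ := by gcongr; exact hSP x y

/-- Both `1 - S` and `1 + S` are positive definite, which confines the eigenvalues of `S` to
`(-1, 1)`. -/
lemma abs_eigenvalues_lt_one {P S : Matrix A A ℝ} (hP : (1 - P).PosDef) (hS : S.IsHermitian)
    (hSP : ∀ x y, |S x y| ≤ P x y) (i : A) : |hS.eigenvalues i| < 1 := by
  have hsymm : S.IsSymm := by
    rwa [IsHermitian, conjTranspose_eq_transpose_of_trivial] at hS
  have hv : (hS.eigenvectorBasis i).ofLp ≠ 0 :=
    (WithLp.ofLp_eq_zero 2).ne.2 (hS.eigenvectorBasis.orthonormal.ne_zero i)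
  have hpos : 0 < (hS.eigenvectorBasis i).ofLp ⬝ᵥ (hS.eigenvectorBasis i).ofLp := by
    simpa using dotProduct_star_self_pos_iff.2 hv
  have h1 := (posDef_one_sub_of_abs_le hP hsymm hSP).dotProduct_mulVec_pos hv
  have h2 := (posDef_one_sub_of_abs_le (S := -S) hP hsymm.neg
    (by simpa using hSP)).dotProduct_mulVec_pos hv
  simp only [sub_mulVec, neg_mulVec, one_mulVec, hS.mulVec_eigenvectorBasis, dotProduct_sub,
    dotProduct_neg, dotProduct_smul, star_trivial, smul_eq_mul] at h1 h2
  rw [abs_lt]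
  constructor <;> nlinarith

lemma trace_pow_eq_sum_eigenvalues_pow {S : Matrix A A ℝ} (hS : S.IsHermitian) (n : ℕ) :
    (S ^ n).trace = ∑ i, hS.eigenvalues i ^ n := by
  conv_lhs => rw [hS.spectral_theorem, ← map_pow, Unitary.conjStarAlgAut_apply, trace_mul_comm,
    ← mul_assoc]
  simp [diagonal_pow, trace_diagonal]

lemma det_one_sub_eq_prod_eigenvalues {S : Matrix A A ℝ} (hS : S.IsHermitian) :
    (1 - S).det = ∏ i, (1 - hS.eigenvalues i) := by
  have h := Matrix.eval_charpoly S 1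
  rw [hS.charpoly_eq, Polynomial.eval_prod] at h
  simpa using h.symm

lemma det_one_add_eq_prod_eigenvalues {S : Matrix A A ℝ} (hS : S.IsHermitian) :
    (1 + S).det = ∏ i, (1 + hS.eigenvalues i) := by
  have h := Matrix.eval_charpoly S (-1)
  rw [hS.charpoly_eq, Polynomial.eval_prod] at h
  have h2 : (scalar A (-1 : ℝ) - S) = -(1 + S) := by
    rw [map_neg, map_one]; abel
  rw [h2, det_neg] at h
  have h3 : ∏ i, Polynomial.eval (-1 : ℝ) (Polynomial.X - Polynomial.C (hS.eigenvalues i : ℝ)) =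
      (-1) ^ Fintype.card A * ∏ i, (1 + hS.eigenvalues i) := by
    rw [← Finset.card_univ, ← Finset.prod_const, ← Finset.prod_mul_distrib]
    refine Finset.prod_congr rfl fun i _ => ?_
    simp; ring
  exact mul_left_cancel₀ (pow_ne_zero _ (by norm_num)) (h.symm.trans h3)

/-- The sum over `n` of `tr (Sⁿ) / n` is `-log det (1 - S)`. -/
lemma hasSum_trace_pow_div {P S : Matrix A A ℝ} (hP : (1 - P).PosDef) (hS : S.IsSymm)
    (hSP : ∀ x y, |S x y| ≤ P x y) :
    HasSum (fun n : ℕ => (S ^ (n + 1)).trace / (n + 1)) (-Real.log (1 - S).det) := by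
  have hH : S.IsHermitian := by
    rwa [IsHermitian, conjTranspose_eq_transpose_of_trivial]
  have hlt := abs_eigenvalues_lt_one hP hH hSP
  have hne : ∀ i, 1 - hH.eigenvalues i ≠ 0 := fun i => by
    have := (abs_lt.1 (hlt i)).2
    linarith
  rw [det_one_sub_eq_prod_eigenvalues hH, Real.log_prod fun i _ => hne i,
    ← Finset.sum_neg_distrib]
  simp_rw [trace_pow_eq_sum_eigenvalues_pow hH, Finset.sum_div]
  exact hasSum_sum fun i _ => Real.hasSum_pow_div_log_of_abs_lt_one (hlt i)

end Matrices

/-! ### The total mass of the loop measure -/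

section LoopMass

variable {A : Type*}

/-- Rooted loops are pairs of a number `n + 1` of steps and a closed path with `n + 1` steps. -/
def loopEquiv (A : Type*) :
    RootedLoop A ≃ Σ n : ℕ, {v : Fin (n + 1 + 1) → A // v 0 = v (Fin.last (n + 1))} where
  toFun ω := match ω with
    | ⟨0, _, h, _⟩ => absurd h (lt_irrefl 0)
    | ⟨n + 1, v, _, h⟩ => ⟨n, v, h⟩
  invFun p := ⟨p.1 + 1, p.2.1, Nat.succ_pos _, p.2.2⟩
  left_inv ω := by
    obtain ⟨_ | n, v, h, h'⟩ := ω
    · exact absurd h (lt_irrefl 0)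
    · rfl
  right_inv p := rfl

variable [Fintype A] [DecidableEq A]

/-- The entries of `Sⁿ` are sums over paths with `n` steps. -/
lemma pow_apply_eq_sum_paths (S : Matrix A A ℝ) (n : ℕ) (x y : A) :
    (S ^ n) x y = ∑ v : Fin (n + 1) → A, if v 0 = x ∧ v (Fin.last n) = y then
      ∏ j : Fin n, S (v j.castSucc) (v j.succ) else 0 := by
  induction n generalizing x with
  | zero =>
    rw [← (Equiv.funUnique (Fin 1) A).symm.sum_comp]
    simp only [pow_zero, Matrix.one_apply, Finset.univ_eq_empty, Finset.prod_empty]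
    rw [Finset.sum_eq_single x] <;> simp +contextual
  | succ n ih =>
    rw [pow_succ', Matrix.mul_apply, ← (Fin.consEquiv fun _ => A).sum_comp,
      Fintype.sum_prod_type]
    simp_rw [ih, Finset.mul_sum]
    rw [Finset.sum_comm, Finset.sum_comm (s := (Finset.univ : Finset A))]
    refine Finset.sum_congr rfl fun v _ => ?_
    rw [Finset.sum_eq_single (v 0), Finset.sum_eq_single x]
    · simp [Fin.consEquiv, Fin.prod_univ_succ, ← Fin.succ_last]
    · intro z _ hz
      simp [Fin.consEquiv, hz]
    · simp
    · intro z _ hz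
      simp [hz.symm]
    · simp

/-- The trace of `Sⁿ` is the sum of the weights of the closed paths with `n` steps. -/
lemma trace_pow_eq_sum_loops (S : Matrix A A ℝ) (n : ℕ) :
    (S ^ n).trace = ∑ v : {v : Fin (n + 1) → A // v 0 = v (Fin.last n)},
      ∏ j : Fin n, S (v.1 j.castSucc) (v.1 j.succ) := by
  simp_rw [Matrix.trace, Matrix.diag, pow_apply_eq_sum_paths]
  rw [Finset.sum_comm, ← Finset.sum_subtype (Finset.univ.filter
    fun v : Fin (n + 1) → A => v 0 = v (Fin.last n)) (by simp)
    (fun v => ∏ j : Fin n, S (v j.castSucc) (v j.succ)), Finset.sum_filter]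
  refine Finset.sum_congr rfl fun v _ => ?_
  rw [Finset.sum_eq_single (v 0)]
  · simp [eq_comm]
  · intro z _ hz
    simp [hz.symm]
  · simp

omit [Fintype A] [DecidableEq A] in
lemma abs_loopMeasure_le {P S : Matrix A A ℝ} (hSP : ∀ x y, |S x y| ≤ P x y) (ω : RootedLoop A) :
    |loopMeasure S ω| ≤ loopMeasure P ω := by
  rw [loopMeasure, loopMeasure, abs_div, Nat.abs_cast, pathWeight, pathWeight, Finset.abs_prod]
  gcongr
  exact hSP _ _

lemma sum_loopMeasure_len (S : Matrix A A ℝ) (n : ℕ) :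
    ∑ v : {v : Fin (n + 1 + 1) → A // v 0 = v (Fin.last (n + 1))},
      loopMeasure S ((loopEquiv A).symm ⟨n, v⟩) = (S ^ (n + 1)).trace / (n + 1) := by
  rw [trace_pow_eq_sum_loops, Finset.sum_div]
  refine Finset.sum_congr rfl fun v _ => ?_
  rw [← Nat.cast_add_one]
  rfl

/-- The loop measure of a dominated symmetric matrix `S` has total mass `-log det (1 - S)`. -/
lemma hasSum_loopMeasure {P S : Matrix A A ℝ} (hP : (1 - P).PosDef) (hPs : P.IsSymm)
    (hS : S.IsSymm) (hSP : ∀ x y, |S x y| ≤ P x y) :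
    Summable (fun ω => |loopMeasure S ω|) ∧
      HasSum (loopMeasure S) (-Real.log (1 - S).det) := by
  have hP0 : ∀ x y, 0 ≤ P x y := fun x y => (abs_nonneg _).trans (hSP x y)
  have hPP : ∀ x y, |P x y| ≤ P x y := fun x y => (abs_of_nonneg (hP0 x y)).le
  have hsP : Summable (loopMeasure P) := by
    rw [← (loopEquiv A).symm.summable_iff, summable_sigma_of_nonneg]
    · refine ⟨fun n => Summable.of_finite, ?_⟩
      simp only [Function.comp_apply, tsum_fintype, sum_loopMeasure_len]
      exact (hasSum_trace_pow_div hP hPs hPP).summable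
    · exact fun p => (abs_nonneg _).trans (abs_loopMeasure_le hPP _)
  have hsS : Summable (fun ω => |loopMeasure S ω|) :=
    hsP.of_nonneg_of_le (fun _ => abs_nonneg _) (abs_loopMeasure_le hSP)
  refine ⟨hsS, ?_⟩
  rw [← (loopEquiv A).symm.hasSum_iff]
  refine HasSum.of_sigma (fun n => hasSum_fintype _) ?_ ?_
  · simp only [Function.comp_apply, sum_loopMeasure_len]
    exact hasSum_trace_pow_div hP hS hSP
  · exact ((loopEquiv A).symm.summable_iff.2 hsS.of_abs).hasSum.cauchySeq

/-- Conjugating `Q` by the square root of a diagonal matrix `d` multiplies the weight of a loop by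
one factor `d x` for each visit to `x`: a closed path visits the same vertices whether or not its
starting point is counted in place of its end point. -/
lemma loopMeasure_sqrt_conj (Q : Matrix A A ℝ) {d : A → ℝ} (hd : ∀ x, 0 < d x)
    (ω : RootedLoop A) :
    loopMeasure (Matrix.of fun x y => √(d x) * Q x y * √(d y)) ω =
      loopMeasure Q ω * ∏ x, d x ^ visits ω x := by
  have h1 : ∏ x, d x ^ visits ω x = ∏ j : Fin ω.len, d (ω.vertex j.succ) := by
    simp only [visits]
    rw [← Finset.prod_fiberwise Finset.univ (fun j : Fin ω.len => ω.vertex j.succ)]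
    refine Finset.prod_congr rfl fun x _ => ?_
    rw [← Finset.prod_const]
    exact Finset.prod_congr rfl fun j hj => by rw [(Finset.mem_filter.1 hj).2]
  have h2 : ∏ j : Fin ω.len, √(d (ω.vertex j.castSucc)) =
      ∏ j : Fin ω.len, √(d (ω.vertex j.succ)) := by
    -- Times the factor at the common endpoint, each side is the product over all `ω.len + 1`
    -- vertices.
    have e1 := Fin.prod_univ_castSucc fun j : Fin (ω.len + 1) => √(d (ω.vertex j))
    have e2 := Fin.prod_univ_succ fun j : Fin (ω.len + 1) => √(d (ω.vertex j))
    rw [← ω.closed] at e1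
    exact mul_right_cancel₀ (Real.sqrt_ne_zero'.2 (hd (ω.vertex 0)))
      (e1.symm.trans (e2.trans (mul_comm _ _)))
  rw [h1, loopMeasure, loopMeasure, pathWeight, pathWeight, div_mul_eq_mul_div]
  simp only [Matrix.of_apply, Finset.prod_mul_distrib]
  rw [h2, mul_right_comm, mul_comm, ← Finset.prod_mul_distrib]
  simp only [Real.mul_self_sqrt (hd _).le]

end LoopMass

/-! ### Exponential sums over finite multisets -/

section ExpSum

open Filter Topology

lemma hasSum_fin_prod {n : ℕ} (f : Fin n → ℕ → ℝ) (c : Fin n → ℝ)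
    (hf : ∀ i, HasSum (f i) (c i)) (hf' : ∀ i, Summable fun n => |f i n|) :
    HasSum (fun k : Fin n → ℕ => ∏ i, f i (k i)) (∏ i, c i) ∧
      Summable fun k : Fin n → ℕ => |∏ i, f i (k i)| := by
  induction n with
  | zero =>
    refine ⟨?_, Summable.of_finite⟩
    simp
  | succ n ih =>
    obtain ⟨h1, h2⟩ := ih (fun i => f i.succ) (fun i => c i.succ) (fun i => hf _) (fun i => hf' _)
    generalize hg : (fun k : Fin n → ℕ => ∏ i, f i.succ (k i)) = g at h1
    have hg' : ∀ k, ∏ i, f (Fin.succ i) (k i) = g k := fun k => congrFun hg k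
    simp only [hg'] at h2
    have habs : Summable fun x : ℕ × (Fin n → ℕ) => |f 0 x.1 * g x.2| := by
      simp_rw [abs_mul]
      exact (hf' 0).mul_of_nonneg h2 (fun _ => abs_nonneg _) fun _ => abs_nonneg _
    have key := (hf 0).mul h1 habs.of_abs
    rw [← (Fin.consEquiv fun _ => ℕ).hasSum_iff, ← (Fin.consEquiv fun _ => ℕ).summable_iff]
    simp only [Function.comp_def, Fin.consEquiv_apply, Fin.prod_univ_succ, Fin.cons_zero,
      Fin.cons_succ, hg']
    exact ⟨key, habs⟩

/-- A finite product of absolutely convergent series can be expanded. -/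
lemma hasSum_pi_prod {ι : Type*} [Fintype ι] (f : ι → ℕ → ℝ) (c : ι → ℝ)
    (hf : ∀ i, HasSum (f i) (c i)) (hf' : ∀ i, Summable fun n => |f i n|) :
    HasSum (fun k : ι → ℕ => ∏ i, f i (k i)) (∏ i, c i) := by
  have e := (Fintype.equivFin ι).symm
  have h := (hasSum_fin_prod (fun i => f (e i)) (fun i => c (e i)) (fun i => hf _)
    fun i => hf' _).1
  rw [e.prod_comp c, ← (e.arrowCongr (Equiv.refl ℕ)).symm.hasSum_iff] at h
  refine h.congr_fun fun k => ?_
  simpa using (e.prod_comp fun i => f i (k i)).symm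

variable {ι : Type*}

lemma hasSum_pow_div_factorial (x : ℝ) :
    HasSum (fun n : ℕ => x ^ n / n.factorial) (Real.exp x) := by
  rw [Real.exp_eq_exp_ℝ]
  exact NormedSpace.expSeries_div_hasSum_exp x

/-- The exponential formula for the multisets supported in a finite set `s`. -/
lemma hasSum_indicator_finsuppProd (s : Finset ι) (a : ι → ℝ) :
    HasSum ({ℓ : ι →₀ ℕ | (ℓ.support : Set ι) ⊆ s}.indicator
      fun ℓ => ℓ.prod fun i k => a i ^ k / k.factorial) (Real.exp (∑ i ∈ s, a i)) := by
  have h := (hasSum_pi_prod (fun (i : s) n => a i ^ n / n.factorial) (fun i => Real.exp (a i))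
    (fun i => hasSum_pow_div_factorial _) (fun i => (hasSum_pow_div_factorial _).summable.abs))
  rw [← Real.exp_sum, Finset.sum_coe_sort s a] at h
  rw [← hasSum_subtype_iff_indicator]
  let e : {ℓ : ι →₀ ℕ | (ℓ.support : Set ι) ⊆ s} ≃ (s → ℕ) :=
    (Finsupp.restrictSupportEquiv (s : Set ι) ℕ).trans Finsupp.equivFunOnFinite
  rw [← e.hasSum_iff] at h
  convert! h using 1
  funext ℓ
  obtain ⟨ℓ, hℓ⟩ := ℓ
  simp only [Function.comp_apply]
  rw [Finsupp.prod_of_support_subset ℓ (by exact_mod_cast hℓ) _ (by simp),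
    ← Finset.prod_coe_sort]
  rfl

/-- The exponential formula: `∑_ℓ ∏ᵢ aᵢ^{ℓᵢ} / ℓᵢ! = exp (∑ᵢ aᵢ)`, the sum being over the finite
multisets `ℓ` of indices. -/
lemma hasSum_finsuppProd {a : ι → ℝ} (ha : Summable fun i => |a i|) :
    HasSum (fun ℓ : ι →₀ ℕ => ℓ.prod fun i k => a i ^ k / k.factorial)
      (Real.exp (∑' i, a i)) ∧
    Summable fun ℓ : ι →₀ ℕ => |ℓ.prod fun i k => a i ^ k / k.factorial| := by
  classical
  have habs : ∀ ℓ : ι →₀ ℕ, |ℓ.prod fun i k => a i ^ k / k.factorial| =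
      ℓ.prod fun i k => |a i| ^ k / k.factorial := fun ℓ => by
    simp [Finsupp.prod, Finset.abs_prod, abs_div]
  have hsum : Summable fun ℓ : ι →₀ ℕ => |ℓ.prod fun i k => a i ^ k / k.factorial| := by
    refine summable_of_sum_le (c := Real.exp (∑' i, |a i|)) (fun _ => abs_nonneg _) fun F => ?_
    obtain ⟨s, hs⟩ : ∃ s : Finset ι, ∀ ℓ ∈ F, ℓ.support ⊆ s :=
      ⟨F.sup Finsupp.support, fun ℓ hℓ => Finset.le_sup (f := Finsupp.support) hℓ⟩
    have h := hasSum_indicator_finsuppProd s fun i => |a i|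
    have hF : ∑ ℓ ∈ F, |ℓ.prod fun i k => a i ^ k / k.factorial| =
        ∑ ℓ ∈ F, ({ℓ : ι →₀ ℕ | (ℓ.support : Set ι) ⊆ s}.indicator
          fun ℓ => ℓ.prod fun i k => |a i| ^ k / k.factorial) ℓ := by
      refine Finset.sum_congr rfl fun ℓ hℓ => ?_
      rw [Set.indicator_of_mem (Finset.coe_subset.2 (hs ℓ hℓ)), habs]
    rw [hF]
    refine (sum_le_hasSum F (fun ℓ _ => Set.indicator_nonneg (fun ℓ _ => ?_) ℓ) h).trans
      (Real.exp_le_exp.2 (ha.sum_le_tsum _ fun _ _ => abs_nonneg _))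
    rw [← habs]
    exact abs_nonneg _
  refine ⟨?_, hsum⟩
  have hlim : Tendsto (fun s : Finset ι => ∑' ℓ : ι →₀ ℕ,
      ({ℓ : ι →₀ ℕ | (ℓ.support : Set ι) ⊆ s}.indicator
        fun ℓ => ℓ.prod fun i k => a i ^ k / k.factorial) ℓ) atTop
      (𝓝 (∑' ℓ : ι →₀ ℕ, ℓ.prod fun i k => a i ^ k / k.factorial)) := by
    refine tendsto_tsum_of_dominated_convergence hsum (fun ℓ => ?_) (.of_forall fun s ℓ => ?_)
    · refine tendsto_const_nhds.congr' ?_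
      filter_upwards [eventually_ge_atTop ℓ.support] with s hs
      rw [Set.indicator_of_mem]
      exact_mod_cast hs
    · exact norm_indicator_le_norm_self _ _
  simp_rw [(hasSum_indicator_finsuppProd _ a).tsum_eq] at hlim
  have hlim' : Tendsto (fun s : Finset ι => Real.exp (∑ i ∈ s, a i)) atTop
      (𝓝 (Real.exp (∑' i, a i))) :=
    Tendsto.rexp (by simpa [HasSum] using ha.of_abs.hasSum)
  rw [← tendsto_nhds_unique hlim hlim']
  exact hsum.of_abs.hasSum

end ExpSum

/-! ### The mass of the loop soup -/

section SoupMass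

variable {A : Type*}

/-- All but finitely many factors are `exp (-mᵢ)`, so the product converges with `∑ᵢ mᵢ`. -/
lemma hasProd_signedPoisson {ι : Type*} {m : ι → ℝ} (hm : Summable m) (ℓ : ι →₀ ℕ) :
    HasProd (fun i => signedPoisson (m i) (ℓ i))
      (Real.exp (-∑' i, m i) * ℓ.prod fun i k => m i ^ k / k.factorial) := by
  have h1 : HasProd (fun i => Real.exp (-m i)) (Real.exp (-∑' i, m i)) := hm.hasSum.neg.rexp
  have h2 : HasProd (fun i => m i ^ ℓ i / (ℓ i).factorial)
      (ℓ.prod fun i k => m i ^ k / k.factorial) :=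
    hasProd_prod_of_ne_finset_one fun i hi => by simp [Finsupp.notMem_support_iff.1 hi]
  refine (h1.mul h2).congr_fun ?_
  intro i
  rw [signedPoisson, mul_div_assoc]

variable {Q : Matrix A A ℝ} (hm : Summable fun ω => |loopMeasure Q ω|) (t : ℝ≥0)
include hm

lemma soupWeight_eq (ℓ : RootedLoop A →₀ ℕ) :
    soupWeight Q t ℓ = Real.exp (-∑' ω, t * loopMeasure Q ω) *
      ℓ.prod fun ω k => (t * loopMeasure Q ω) ^ k / k.factorial :=
  (hasProd_signedPoisson (hm.of_abs.mul_left _) ℓ).tprod_eq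

lemma summable_soupWeight : Summable fun ℓ => |soupWeight Q t ℓ| := by
  simp_rw [soupWeight_eq hm t, abs_mul]
  refine (hasSum_finsuppProd (a := fun ω => t * loopMeasure Q ω) ?_).2.mul_left _
  simpa [abs_mul] using hm.mul_left (t : ℝ)

/-- The generating function of the local time of the loop soup. -/
lemma hasSum_soupWeight_mul_pow_localTime [Fintype A] [DecidableEq A] {d : A → ℝ}
    (hd : Summable fun ω => |loopMeasure Q ω * ∏ x, d x ^ visits ω x|) :
    HasSum (fun ℓ => soupWeight Q t ℓ * ∏ x, d x ^ localTime ℓ x)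
      (Real.exp (t * (∑' ω, loopMeasure Q ω * ∏ x, d x ^ visits ω x) -
        t * ∑' ω, loopMeasure Q ω)) := by
  have hd' : Summable fun ω => |t * (loopMeasure Q ω * ∏ x, d x ^ visits ω x)| := by
    simp_rw [abs_mul (t : ℝ)]
    exact hd.mul_left _
  have h := (hasSum_finsuppProd hd').1.mul_left (Real.exp (-∑' ω, t * loopMeasure Q ω))
  rw [← Real.exp_add, neg_add_eq_sub, tsum_mul_left, tsum_mul_left] at h
  convert! h using 1
  funext ℓ
  rw [soupWeight_eq hm, mul_assoc, tsum_mul_left]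
  congr 1
  have hloc : ∀ x, d x ^ localTime ℓ x = ℓ.prod fun ω k => (d x ^ visits ω x) ^ k := fun x => by
    rw [localTime, Finsupp.sum, Finsupp.prod, ← Finset.prod_pow_eq_pow_sum]
    exact Finset.prod_congr rfl fun ω _ => by rw [mul_comm, pow_mul]
  simp_rw [hloc, Finsupp.prod]
  rw [Finset.prod_comm, ← Finset.prod_mul_distrib]
  refine Finset.prod_congr rfl fun ω _ => ?_
  rw [Finset.prod_pow, ← mul_assoc, mul_pow]
  ring

end SoupMass

/-! ### Laplace transforms determine signed mixtures -/

section Laplace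

open BoundedContinuousFunction

variable {A : Type*} [Fintype A]

/-- The Laplace transform at `u` of a measure on `ℝ^A`. -/
noncomputable def laplace (μ : Measure (A → ℝ)) (u : A → ℝ) : ℝ :=
  ∫ y, Real.exp (-∑ x, u x * y x) ∂μ

/-- The function `y ↦ exp (-⟨u, y⟩)`, which is bounded and continuous on the orthant
`[0, ∞)^A`. -/
noncomputable def expNegInner (u : A → ℝ≥0) : (A → ℝ≥0) →ᵇ ℝ :=
  BoundedContinuousFunction.ofNormedAddCommGroup
    (fun y => Real.exp (-∑ x, (u x : ℝ) * (y x : ℝ))) (by fun_prop) 1 fun y => by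
      rw [Real.norm_eq_abs, Real.abs_exp, Real.exp_le_one_iff, neg_nonpos]
      positivity

/-- The functions `y ↦ exp (-⟨u, y⟩)` form a monoid under multiplication. -/
noncomputable def expNegInnerHom : Multiplicative (A → ℝ≥0) →* ((A → ℝ≥0) →ᵇ ℝ) where
  toFun u := expNegInner u.toAdd
  map_one' := by
    ext y
    simp [expNegInner]
  map_mul' u v := by
    ext y
    simp [expNegInner, ← Real.exp_add, add_mul, Finset.sum_add_distrib, add_comm]

/-- The linear combinations of the functions `y ↦ exp (-⟨u, y⟩)`. -/
noncomputable def expNegInnerAlgebra (A : Type*) [Fintype A] :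
    StarSubalgebra ℝ ((A → ℝ≥0) →ᵇ ℝ) where
  toSubalgebra := Algebra.adjoin ℝ (MonoidHom.mrange (expNegInnerHom (A := A)))
  star_mem' {f} hf := by
    have : star f = f := by ext; simp
    rwa [this]

/-- By the Stone-Weierstrass theorem, a finite measure on the orthant is determined by its
Laplace transform. -/
lemma orthant_ext_of_laplace {μ ν : Measure (A → ℝ≥0)} [IsFiniteMeasure μ] [IsFiniteMeasure ν]
    (h : ∀ u, ∫ y, expNegInner u y ∂μ = ∫ y, expNegInner u y ∂ν) : μ = ν := by
  refine ext_of_forall_mem_subalgebra_integral_eq_of_polish (𝕜 := ℝ)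
    (A := expNegInnerAlgebra A) ?_ fun g hg => ?_
  · classical
    intro y z hyz
    obtain ⟨x, hx⟩ := Function.ne_iff.1 hyz
    refine ⟨expNegInner (Pi.single x 1), ⟨_, ⟨expNegInner (Pi.single x 1),
      Algebra.subset_adjoin ⟨Multiplicative.ofAdd (Pi.single x 1), rfl⟩, rfl⟩, rfl⟩, ?_⟩
    simpa [expNegInner, Pi.single_apply, apply_ite NNReal.toReal] using hx
  · have hg' : g ∈ Submodule.span ℝ
        (MonoidHom.mrange (expNegInnerHom (A := A)) : Set ((A → ℝ≥0) →ᵇ ℝ)) := by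
      have h1 : g ∈ Subalgebra.toSubmodule
          (Algebra.adjoin ℝ (MonoidHom.mrange (expNegInnerHom (A := A)) :
            Set ((A → ℝ≥0) →ᵇ ℝ))) := hg
      rwa [Algebra.adjoin_eq_span, Submonoid.closure_eq] at h1
    clear hg
    induction hg' using Submodule.span_induction with
    | mem f hf =>
      obtain ⟨u, rfl⟩ := hf
      exact h u.toAdd
    | zero => simp
    | add f g _ _ hf hg =>
      simp only [BoundedContinuousFunction.coe_add, Pi.add_apply]
      rw [integral_add (f.integrable μ) (g.integrable μ),
        integral_add (f.integrable ν) (g.integrable ν), hf, hg]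
    | smul c f _ hf =>
      simp only [BoundedContinuousFunction.coe_smul]
      rw [integral_smul, integral_smul, hf]

/-- Uniqueness for measures on `ℝ^A` that are carried by the orthant, which are transported to
`ℝ≥0^A` and back. -/
lemma ext_of_laplace {μ ν : Measure (A → ℝ)} [IsFiniteMeasure μ] [IsFiniteMeasure ν]
    (hμ : ∀ᵐ y ∂μ, 0 ≤ y) (hν : ∀ᵐ y ∂ν, 0 ≤ y)
    (h : ∀ u, 0 ≤ u → laplace μ u = laplace ν u) : μ = ν := by
  let p : (A → ℝ) → (A → ℝ≥0) := fun y x => (y x).toNNReal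
  let q : (A → ℝ≥0) → (A → ℝ) := fun y x => y x
  have hp : Measurable p := by fun_prop
  have hq : Measurable q := by fun_prop
  have hqp : ∀ y, 0 ≤ y → q (p y) = y := fun y hy => by
    ext x
    exact Real.coe_toNNReal _ (hy x)
  have hback : ∀ ρ : Measure (A → ℝ), (∀ᵐ y ∂ρ, 0 ≤ y) → (ρ.map p).map q = ρ := fun ρ hρ => by
    rw [Measure.map_map hq hp]
    conv_rhs => rw [← Measure.map_id (μ := ρ)]
    exact Measure.map_congr (hρ.mono hqp)
  have hlap : ∀ ρ : Measure (A → ℝ), (∀ᵐ y ∂ρ, 0 ≤ y) → ∀ u : A → ℝ≥0,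
      ∫ y, expNegInner u y ∂(ρ.map p) = laplace ρ fun x => u x := fun ρ hρ u => by
    rw [integral_map hp.aemeasurable (expNegInner u).continuous.aestronglyMeasurable]
    refine integral_congr_ae (hρ.mono fun y hy => ?_)
    have : ∀ x, ((p y x : ℝ≥0) : ℝ) = y x := fun x => congrFun (hqp y hy) x
    simp [expNegInner, this]
  have hpq : μ.map p = ν.map p := orthant_ext_of_laplace fun u => by
    rw [hlap μ hμ, hlap ν hν]
    exact h _ fun x => (u x).2
  rw [← hback μ hμ, ← hback ν hν, hpq]

end Laplace

section Mixtures

variable {ι E : Type*} [MeasurableSpace E]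

lemma signedMixture_apply {w : ι → ℝ} (hw : Summable w) (κ : ι → Measure E)
    [∀ i, IsProbabilityMeasure (κ i)] {V : Set E} (hV : MeasurableSet V) :
    signedMixture w κ V = ∑' i, w i * (κ i).real V := by
  rw [signedMixture, dif_pos hw]
  exact if_pos hV

/-- The positive measure `∑ᵢ wᵢ κᵢ`, the negative weights being discarded. -/
noncomputable def mixture (w : ι → ℝ) (κ : ι → Measure E) : Measure E :=
  Measure.sum fun i => ENNReal.ofReal (w i) • κ i

variable {w : ι → ℝ} (hw : Summable w) (hw0 : ∀ i, 0 ≤ w i) (κ : ι → Measure E)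
  [∀ i, IsProbabilityMeasure (κ i)]
include hw hw0

lemma isFiniteMeasure_mixture : IsFiniteMeasure (mixture w κ) := by
  constructor
  rw [mixture, Measure.sum_apply _ MeasurableSet.univ]
  simp only [Measure.smul_apply, measure_univ, smul_eq_mul, mul_one]
  rw [← ENNReal.ofReal_tsum_of_nonneg hw0 hw]
  exact ENNReal.ofReal_lt_top

omit hw [∀ i, IsProbabilityMeasure (κ i)] in
lemma integral_mixture {f : E → ℝ} (hf : Integrable f (mixture w κ)) :
    ∫ y, f y ∂(mixture w κ) = ∑' i, w i * ∫ y, f y ∂(κ i) := by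
  rw [mixture, integral_sum_measure hf]
  simp [integral_smul_measure, ENNReal.toReal_ofReal (hw0 _)]

lemma mixture_real_apply {V : Set E} (hV : MeasurableSet V) :
    (mixture w κ).real V = ∑' i, w i * (κ i).real V := by
  have := isFiniteMeasure_mixture hw hw0 κ
  have h := integral_mixture hw0 κ ((integrable_const (1 : ℝ)).indicator hV)
  simpa only [integral_indicator_const _ hV, smul_eq_mul, mul_one] using h

end Mixtures

section Uniqueness

variable {A ι : Type*} [Fintype A]

lemma integrable_exp_neg_inner (μ : Measure (A → ℝ)) [IsFiniteMeasure μ] (hμ : ∀ᵐ y ∂μ, 0 ≤ y)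
    {u : A → ℝ} (hu : 0 ≤ u) : Integrable (fun y => Real.exp (-∑ x, u x * y x)) μ := by
  refine Integrable.of_bound
    (by fun_prop : Measurable fun y : A → ℝ => Real.exp (-∑ x, u x * y x)).aestronglyMeasurable 1
    (hμ.mono fun y hy => ?_)
  rw [Real.norm_eq_abs, Real.abs_exp, Real.exp_le_one_iff, neg_nonpos]
  exact Finset.sum_nonneg fun x _ => mul_nonneg (hu x) (hy x)

lemma ae_mixture_nonneg {w : ι → ℝ} {κ : ι → Measure (A → ℝ)}
    (hκ : ∀ i, ∀ᵐ y ∂(κ i), 0 ≤ y) : ∀ᵐ y ∂(mixture w κ), 0 ≤ y := by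
  have hmeas : MeasurableSet {y : A → ℝ | 0 ≤ y} := isClosed_Ici.measurableSet
  change mixture w κ {y | 0 ≤ y}ᶜ = 0
  rw [mixture, Measure.sum_apply _ hmeas.compl]
  simp only [Measure.smul_apply, smul_eq_mul, ENNReal.tsum_eq_zero, mul_eq_zero]
  exact fun i => .inr (ae_iff.1 (hκ i))

/-- A finite measure on the orthant equals a signed mixture as soon as the Laplace transforms
agree: moving the negative part of the mixture to the other side leaves an identity between two
positive measures. -/
lemma toSignedMeasure_eq_signedMixture {w : ι → ℝ} (hw : Summable w) (κ : ι → Measure (A → ℝ))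
    [∀ i, IsProbabilityMeasure (κ i)] (hκ : ∀ i, ∀ᵐ y ∂(κ i), 0 ≤ y) (μ : Measure (A → ℝ))
    [IsFiniteMeasure μ] (hμ : ∀ᵐ y ∂μ, 0 ≤ y)
    (h : ∀ u, 0 ≤ u → laplace μ u = ∑' i, w i * laplace (κ i) u) :
    μ.toSignedMeasure = signedMixture w κ := by
  have hp : Summable fun i => max (w i) 0 :=
    hw.abs.of_nonneg_of_le (fun i => le_max_right _ _)
      fun i => max_le (le_abs_self _) (abs_nonneg _)
  have hn : Summable fun i => max (-w i) 0 :=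
    hw.abs.of_nonneg_of_le (fun i => le_max_right _ _)
      fun i => max_le (neg_le_abs _) (abs_nonneg _)
  have hp0 : ∀ i, 0 ≤ max (w i) 0 := fun i => le_max_right _ _
  have hn0 : ∀ i, 0 ≤ max (-w i) 0 := fun i => le_max_right _ _
  have hsub : ∀ i, w i = max (w i) 0 - max (-w i) 0 := fun i => by
    rcases le_total (w i) 0 with h | h <;> simp [h]
  have := isFiniteMeasure_mixture hp hp0 κ
  have := isFiniteMeasure_mixture hn hn0 κ
  have hsplit : ∀ c : ι → ℝ, (∀ i, 0 ≤ c i) → (∀ i, c i ≤ 1) →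
      ∑' i, w i * c i = ∑' i, max (w i) 0 * c i - ∑' i, max (-w i) 0 * c i := fun c hc0 hc1 => by
    rw [← Summable.tsum_sub]
    · exact tsum_congr fun i => by rw [← sub_mul, ← hsub]
    · exact hp.of_nonneg_of_le (fun i => mul_nonneg (hp0 i) (hc0 i))
        fun i => mul_le_of_le_one_right (hp0 i) (hc1 i)
    · exact hn.of_nonneg_of_le (fun i => mul_nonneg (hn0 i) (hc0 i))
        fun i => mul_le_of_le_one_right (hn0 i) (hc1 i)
  -- `N` and `P` below stand for the mixtures with the negative and the positive parts of `w`.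
  have hN := ae_mixture_nonneg (w := fun i => max (-w i) 0) hκ
  have hP := ae_mixture_nonneg (w := fun i => max (w i) 0) hκ
  have key : μ + mixture (fun i => max (-w i) 0) κ = mixture (fun i => max (w i) 0) κ := by
    refine ext_of_laplace ?_ hP fun u hu => ?_
    · rw [ae_add_measure_iff]
      exact ⟨hμ, hN⟩
    · have hi := integrable_exp_neg_inner _ hμ hu
      have hiN := integrable_exp_neg_inner _ hN hu
      have hiP := integrable_exp_neg_inner _ hP hu
      have e := h u hu
      rw [hsplit] at e
      · unfold laplace at e ⊢
        rw [integral_add_measure hi hiN, integral_mixture hn0 κ hiN, integral_mixture hp0 κ hiP, e,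
          sub_add_cancel]
      · exact fun i => integral_nonneg fun y => (Real.exp_pos _).le
      · intro i
        have hle := integral_mono_ae (integrable_exp_neg_inner _ (hκ i) hu)
          (integrable_const (1 : ℝ)) ((hκ i).mono fun y hy => ?_)
        · simpa [laplace] using hle
        · rw [Real.exp_le_one_iff, neg_nonpos]
          exact Finset.sum_nonneg fun x _ => mul_nonneg (hu x) (hy x)
  ext V hV
  rw [signedMixture_apply hw κ hV, Measure.toSignedMeasure_apply_measurable hV,
    hsplit _ (fun i => measureReal_nonneg) (fun i => measureReal_le_one),
    ← mixture_real_apply hp hp0 κ hV, ← mixture_real_apply hn hn0 κ hV, ← key,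
    measureReal_add_apply, add_sub_cancel_right]

end Uniqueness

/-! ### Convolution of signed mixtures -/

section Convolution

/-- Convolution can be taken inside a signed mixture: the mixture of the products
`κᵢ × ν` has the values on rectangles that characterise the product of signed measures. -/
lemma signedConv_signedMixture {ι E : Type*} [MeasurableSpace E] [AddMonoid E] [MeasurableAdd₂ E]
    {w : ι → ℝ} (hw : Summable w) (κ : ι → Measure E) [∀ i, IsProbabilityMeasure (κ i)]
    (ν : Measure E) [IsProbabilityMeasure ν] :
    signedConv (signedMixture w κ) ν.toSignedMeasure = signedMixture w fun i => κ i ∗ ν := by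
  have hprod : (signedMixture w κ).prod ν.toSignedMeasure (ContinuousLinearMap.mul ℝ ℝ) =
      signedMixture w fun i => (κ i).prod ν := by
    refine VectorMeasure.prod_eq_of_forall_apply_prod fun s t hs ht => ?_
    rw [signedMixture_apply hw _ (hs.prod ht), signedMixture_apply hw _ hs,
      Measure.toSignedMeasure_apply_measurable ht, ContinuousLinearMap.mul_apply', ← tsum_mul_right]
    exact tsum_congr fun i => by rw [measureReal_prod_prod, mul_assoc]
  have hadd : Measurable fun p : E × E => p.1 + p.2 := by fun_prop
  ext V hV
  rw [signedConv, hprod, VectorMeasure.map_apply _ hadd hV, signedMixture_apply hw _ hV,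
    signedMixture_apply hw _ (hadd hV)]
  exact tsum_congr fun i => by rw [Measure.conv, map_measureReal_apply hadd hV]

variable {A : Type*} [Fintype A]

lemma laplace_conv (μ ν : Measure (A → ℝ)) [SFinite μ] [SFinite ν] (u : A → ℝ) :
    laplace (μ ∗ ν) u = laplace μ u * laplace ν u := by
  rw [laplace, Measure.conv, integral_map (by fun_prop)
    (by fun_prop : Measurable fun y : A → ℝ => Real.exp (-∑ x, u x * y x)).aestronglyMeasurable,
    laplace, laplace, ← integral_prod_mul]
  simp only [Pi.add_apply, mul_add, Finset.sum_add_distrib, neg_add, Real.exp_add]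

lemma ae_conv_nonneg {μ ν : Measure (A → ℝ)} [SFinite μ] [SFinite ν] (hμ : ∀ᵐ y ∂μ, 0 ≤ y)
    (hν : ∀ᵐ y ∂ν, 0 ≤ y) : ∀ᵐ y ∂(μ ∗ ν), 0 ≤ y := by
  rw [Measure.conv, ae_map_iff (by fun_prop) isClosed_Ici.measurableSet]
  filter_upwards [Measure.quasiMeasurePreserving_fst.ae hμ,
    Measure.quasiMeasurePreserving_snd.ae hν] with p h1 h2
  exact add_nonneg h1 h2

end Convolution

/-! ### Laplace transforms of gamma fields -/

section GammaLaplace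

lemma integral_exp_neg_mul_gammaLaw (s : ℝ≥0) {u : ℝ} (hu : 0 ≤ u) :
    ∫ y, Real.exp (-(u * y)) ∂(gammaLaw s) = (1 + u)⁻¹ ^ (s : ℝ) := by
  rw [gammaLaw]
  split_ifs with hs
  · simp [hs]
  · have hs' : (0 : ℝ) < s := NNReal.coe_pos.2 (pos_iff_ne_zero.2 hs)
    rw [gammaMeasure, integral_withDensity_eq_integral_toReal_smul (by unfold gammaPDF; fun_prop)
      (by simp [gammaPDF])]
    have h : ∀ y, (gammaPDF s 1 y).toReal • Real.exp (-(u * y)) = (Set.Ici (0 : ℝ)).indicator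
        (fun y => (Real.Gamma s)⁻¹ * (y ^ ((s : ℝ) - 1) * Real.exp (-((1 + u) * y)))) y := by
      intro y
      rw [gammaPDF, ENNReal.toReal_ofReal (gammaPDFReal_nonneg hs' one_pos y), gammaPDFReal,
        Set.indicator_apply]
      simp only [Set.mem_Ici]
      split_ifs
      · rw [smul_eq_mul, Real.one_rpow, one_div, mul_assoc, mul_assoc, ← Real.exp_add]
        ring_nf
      · simp
    simp_rw [h]
    rw [integral_indicator measurableSet_Ici, integral_Ici_eq_integral_Ioi, integral_const_mul,
      Real.integral_rpow_mul_exp_neg_mul_Ioi hs' (by linarith), one_div]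
    have := (Real.Gamma_pos_of_pos hs').ne'
    field_simp

lemma ae_gammaLaw_nonneg (s : ℝ≥0) : ∀ᵐ y ∂(gammaLaw s), 0 ≤ y := by
  rw [gammaLaw]
  split_ifs
  · simp
  · rw [gammaMeasure, ae_withDensity_iff (by unfold gammaPDF; fun_prop)]
    refine .of_forall fun y hy => ?_
    by_contra hneg
    exact hy (gammaPDF_of_neg (not_le.1 hneg))

variable {A : Type*} [Fintype A]

lemma laplace_gammaFieldLaw (s : A → ℝ≥0) {u : A → ℝ} (hu : 0 ≤ u) :
    laplace (gammaFieldLaw s) u = ∏ x, (1 + u x)⁻¹ ^ (s x : ℝ) := by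
  simp_rw [laplace, gammaFieldLaw, ← Finset.sum_neg_distrib, Real.exp_sum]
  rw [integral_fintype_prod_eq_prod (fun x y => Real.exp (-(u x * y)))]
  exact Finset.prod_congr rfl fun x _ => integral_exp_neg_mul_gammaLaw _ (hu x)

lemma ae_gammaFieldLaw_nonneg (s : A → ℝ≥0) : ∀ᵐ y ∂(gammaFieldLaw s), 0 ≤ y := by
  simp only [Pi.le_def, Pi.zero_apply]
  rw [Filter.eventually_all]
  exact fun x => (measurePreserving_eval (fun x => gammaLaw (s x)) x).quasiMeasurePreserving.ae
    (ae_gammaLaw_nonneg (s x))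

end GammaLaplace

/-! ### The Laplace transform of the squared Gaussian free field -/

section GaussianLaplace

open Matrix
open scoped MatrixOrder

lemma integral_exp_neg_mul_sq_gaussianReal {c : ℝ} (hc : 0 ≤ c) :
    ∫ z, Real.exp (-(c * z ^ 2 / 2)) ∂(gaussianReal 0 1) = (√(1 + c))⁻¹ := by
  rw [integral_gaussianReal_eq_integral_smul one_ne_zero]
  have h : ∀ z : ℝ, gaussianPDFReal 0 1 z • Real.exp (-(c * z ^ 2 / 2)) =
      (√(2 * Real.pi))⁻¹ * Real.exp (-((1 + c) / 2) * z ^ 2) := by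
    intro z
    rw [gaussianPDFReal, smul_eq_mul, mul_assoc, ← Real.exp_add]
    simp only [NNReal.coe_one, mul_one, sub_zero]
    ring_nf
  simp_rw [h]
  rw [integral_const_mul, integral_gaussian, ← Real.sqrt_inv, ← Real.sqrt_inv,
    ← Real.sqrt_mul (by positivity)]
  congr 1
  have := Real.pi_pos
  field_simp

variable {A : Type*} [Fintype A] [DecidableEq A]

/-- Diagonalising `M` turns the Gaussian integral into a product of one-dimensional ones, by the
rotation invariance of the standard Gaussian measure. -/
lemma integral_exp_neg_quadraticForm_stdGaussian {M : Matrix A A ℝ} (hM : M.PosSemidef) :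
    ∫ z, Real.exp (-(z.ofLp ⬝ᵥ M *ᵥ z.ofLp / 2)) ∂(stdGaussian (EuclideanSpace ℝ A)) =
      (√(1 + M).det)⁻¹ := by
  have hH := hM.isHermitian
  have hquad : ∀ y : A → ℝ, (∑ i, y i • hH.eigenvectorBasis i).ofLp ⬝ᵥ
      M *ᵥ (∑ i, y i • hH.eigenvectorBasis i).ofLp = ∑ i, hH.eigenvalues i * y i ^ 2 := by
    intro y
    have h1 : M *ᵥ (∑ i, y i • hH.eigenvectorBasis i).ofLp =
        (∑ i, (hH.eigenvalues i * y i) • hH.eigenvectorBasis i).ofLp := by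
      simp only [WithLp.ofLp_sum, WithLp.ofLp_smul, mulVec_sum, mulVec_smul,
        hH.mulVec_eigenvectorBasis, smul_smul]
      simp only [mul_comm]
    have h2 := hH.eigenvectorBasis.orthonormal.inner_sum (fun i => hH.eigenvalues i * y i) y
      Finset.univ
    rw [EuclideanSpace.inner_eq_star_dotProduct] at h2
    rw [h1]
    simp only [star_trivial, conj_trivial] at h2
    rw [h2]
    exact Finset.sum_congr rfl fun i _ => by ring
  rw [stdGaussian_eq_map_pi_orthonormalBasis hH.eigenvectorBasis,
    integral_map (Measurable.aemeasurable (by fun_prop))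
    (by unfold dotProduct mulVec dotProduct; fun_prop)]
  simp_rw [hquad, Finset.sum_div, ← Finset.sum_neg_distrib, Real.exp_sum]
  rw [integral_fintype_prod_eq_prod (fun i z => Real.exp (-(hH.eigenvalues i * z ^ 2 / 2))),
    det_one_add_eq_prod_eigenvalues hH, ← Real.sqrt_inv, ← Finset.prod_inv_distrib,
    Real.sqrt_prod]
  · exact Finset.prod_congr rfl fun i _ => by
      rw [integral_exp_neg_mul_sq_gaussianReal (hM.eigenvalues_nonneg i), Real.sqrt_inv]
  · intro i _
    have := hM.eigenvalues_nonneg i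
    positivity

/-- With `C = √G` and `Z` standard Gaussian, `∑ₓ u x (C Z)ₓ²` is the quadratic form of `C u C` at
`Z`, and `det (1 + C u C) = det (1 + u G)`. -/
lemma integral_exp_neg_multivariateGaussian {G : Matrix A A ℝ} (hG : G.PosSemidef) {u : A → ℝ}
    (hu : 0 ≤ u) :
    ∫ z : EuclideanSpace ℝ A, Real.exp (-∑ x, u x * (z x ^ 2 / 2)) ∂(multivariateGaussian 0 G) =
      (√(1 + diagonal u * G).det)⁻¹ := by
  have hC : (CFC.sqrt G).IsHermitian := (CFC.sqrt_nonneg G).isSelfAdjoint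
  have hM : (CFC.sqrt G * diagonal u * CFC.sqrt G).PosSemidef := by
    have := (PosSemidef.diagonal hu).conjTranspose_mul_mul_same (CFC.sqrt G)
    rwa [hC.eq] at this
  have hdet : (1 + CFC.sqrt G * diagonal u * CFC.sqrt G).det = (1 + diagonal u * G).det := by
    rw [mul_assoc, det_one_add_mul_comm, mul_assoc, CFC.sqrt_mul_sqrt_self _ hG.nonneg]
  rw [← hdet, ← integral_exp_neg_quadraticForm_stdGaussian hM, multivariateGaussian,
    integral_map (by fun_prop) (by fun_prop)]
  refine integral_congr_ae (.of_forall fun z => ?_)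
  simp only [zero_add]
  have h1 : z.ofLp ⬝ᵥ (CFC.sqrt G * diagonal u * CFC.sqrt G) *ᵥ z.ofLp =
      ∑ x, u x * (toEuclideanCLM (𝕜 := ℝ) (CFC.sqrt G) z).ofLp x ^ 2 := by
    rw [mul_assoc, ← mulVec_mulVec, dotProduct_mulVec, ← mulVec_transpose]
    have : (CFC.sqrt G)ᵀ = CFC.sqrt G := by
      rw [← conjTranspose_eq_transpose_of_trivial]; exact hC
    rw [this, ← mulVec_mulVec]
    simp only [dotProduct, mulVec_diagonal, ofLp_toEuclideanCLM]
    exact Finset.sum_congr rfl fun x _ => by ring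
  rw [h1, Finset.sum_div]
  simp only [mul_div_assoc]

omit [Fintype A] [DecidableEq A] in
lemma aemeasurable_sq_div_two {Ω : Type*} [MeasurableSpace Ω] {P : Measure Ω} {φ : Ω → A → ℝ}
    (hφ : AEMeasurable (fun ω => WithLp.toLp 2 (φ ω)) P) :
    AEMeasurable (fun ω x => φ ω x ^ 2 / 2) P := by
  have hφm : AEMeasurable φ P := (WithLp.measurable_ofLp 2 _).comp_aemeasurable hφ
  have hsq : Measurable fun (z : A → ℝ) x => z x ^ 2 / 2 := by fun_prop
  exact hsq.comp_aemeasurable hφm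

/-- The Laplace transform of `½ φ²` is `det (1 + u G)^{-1/2}`. -/
lemma laplace_map_sq_freeField {Ω : Type*} [MeasurableSpace Ω] {P : Measure Ω}
    {G : Matrix A A ℝ} (hG : G.PosSemidef) {φ : Ω → A → ℝ} (hφ : IsGaussianFreeField P G φ)
    {u : A → ℝ} (hu : 0 ≤ u) :
    laplace (P.map fun ω x => φ ω x ^ 2 / 2) u = (√(1 + diagonal u * G).det)⁻¹ := by
  rw [laplace, integral_map (aemeasurable_sq_div_two hφ.aemeasurable)
    (by fun_prop : Measurable fun y : A → ℝ => Real.exp (-∑ x, u x * y x)).aestronglyMeasurable,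
    ← integral_exp_neg_multivariateGaussian hG hu]
  exact hφ.integral_comp (f := fun z : EuclideanSpace ℝ A =>
    Real.exp (-∑ x, u x * (z x ^ 2 / 2)))
    (by fun_prop : Measurable fun z : EuclideanSpace ℝ A =>
      Real.exp (-∑ x, u x * (z x ^ 2 / 2))).aestronglyMeasurable

end GaussianLaplace

/-! ### The isomorphism theorem -/

section Isomorphism

open Matrix

variable {A : Type*} [Fintype A] [DecidableEq A] {Q : Matrix A A ℝ}

/-- With `d = (1 + u)⁻¹`, the matrix `1 - √d Q √d` factors as `√d (1 - Q + u) √d`. -/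
lemma det_one_sub_sqrt_conj {u : A → ℝ} (hu : 0 ≤ u) :
    (1 - of fun x y => √(1 + u x)⁻¹ * Q x y * √(1 + u y)⁻¹).det =
      (∏ x, (1 + u x)⁻¹) * (1 - Q + diagonal u).det := by
  have h : (1 - of fun x y => √(1 + u x)⁻¹ * Q x y * √(1 + u y)⁻¹) =
      diagonal (fun x => √(1 + u x)⁻¹) * (1 - Q + diagonal u) *
        diagonal (fun x => √(1 + u x)⁻¹) := by
    ext x y
    have hx : 0 < 1 + u x := by linarith [hu x, show (0 : A → ℝ) x = 0 from rfl]
    rw [mul_diagonal, diagonal_mul]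
    by_cases hxy : x = y
    · subst hxy
      have hs : √(1 + u x)⁻¹ * √(1 + u x)⁻¹ * (1 + u x) = 1 := by
        rw [Real.mul_self_sqrt (inv_nonneg.2 hx.le), inv_mul_cancel₀ hx.ne']
      simp only [Matrix.sub_apply, Matrix.add_apply, one_apply_eq, of_apply, diagonal_apply_eq]
      linear_combination -hs
    · simp [hxy, one_apply_ne hxy]
  rw [h, det_mul, det_mul, det_diagonal, mul_right_comm, ← Finset.prod_mul_distrib]
  congr 1
  refine Finset.prod_congr rfl fun x _ => Real.mul_self_sqrt (inv_nonneg.2 ?_)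
  linarith [hu x, show (0 : A → ℝ) x = 0 from rfl]

/-- The identity of scalars that matches the two transforms, for `a = det (1 - Q)`,
`b = det (1 - Q + u)` and `p = ∏ₓ (1 + u x)⁻¹`. -/
lemma exp_half_log_mul_rpow {a b p : ℝ} (ha : 0 < a) (hb : 0 < b) (hp : 0 < p) :
    Real.exp (1 / 2 * -Real.log (p * b) - 1 / 2 * -Real.log a) * p ^ (1 / 2 : ℝ) =
      (√(b / a))⁻¹ := by
  rw [Real.sqrt_eq_rpow, ← Real.rpow_neg (div_pos hb ha).le, Real.rpow_def_of_pos hp,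
    Real.rpow_def_of_pos (div_pos hb ha), ← Real.exp_add, Real.log_mul hp.ne' hb.ne',
    Real.log_div hb.ne' ha.ne']
  ring_nf

lemma Acceptable.posDef_one_sub (hacc : Acceptable Q) (hQ : Q.IsSymm) : (1 - Q).PosDef :=
  posDef_one_sub_of_abs_le (hacc.posDef_one_sub_abs hQ) hQ fun _ _ => le_rfl

lemma Acceptable.hasSum_loopMeasure_sqrt_conj (hacc : Acceptable Q) (hQ : Q.IsSymm) {d : A → ℝ}
    (hd : ∀ x, 0 < d x) (hd1 : ∀ x, d x ≤ 1) :
    Summable (fun ω => |loopMeasure Q ω * ∏ x, d x ^ visits ω x|) ∧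
      HasSum (fun ω => loopMeasure Q ω * ∏ x, d x ^ visits ω x)
        (-Real.log (1 - of fun x y => √(d x) * Q x y * √(d y)).det) := by
  simp_rw [← loopMeasure_sqrt_conj Q hd]
  refine hasSum_loopMeasure (hacc.posDef_one_sub_abs hQ) ?_ ?_ fun x y => ?_
  · ext x y
    simp [hQ.apply x y]
  · ext x y
    simp only [transpose_apply, of_apply, hQ.apply x y]
    ring
  · have hs : ∀ x, √(d x) ≤ 1 := fun x => Real.sqrt_le_one.2 (hd1 x)
    rw [of_apply, map_apply, abs_mul, abs_mul, abs_of_nonneg (Real.sqrt_nonneg _),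
      abs_of_nonneg (Real.sqrt_nonneg _)]
    exact (mul_le_of_le_one_right (by positivity) (hs y)).trans
      (mul_le_of_le_one_left (abs_nonneg _) (hs x))

lemma Acceptable.hasSum_loopMeasure (hacc : Acceptable Q) (hQ : Q.IsSymm) :
    Summable (fun ω => |loopMeasure Q ω|) ∧ HasSum (loopMeasure Q) (-Real.log (1 - Q).det) :=
  LoopSoup.hasSum_loopMeasure (hacc.posDef_one_sub_abs hQ) (by ext x y; simp [hQ.apply x y]) hQ
    fun _ _ => le_rfl

/-- The Laplace transform of the mixture that represents `ρ_{1/2}`. -/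
lemma Acceptable.tsum_soupWeight_mul_laplace (hacc : Acceptable Q) (hQ : Q.IsSymm) {u : A → ℝ}
    (hu : 0 ≤ u) :
    ∑' ℓ, soupWeight Q (1 / 2) ℓ * laplace
      ((gammaFieldLaw fun x => (localTime ℓ x : ℝ≥0)) ∗ trivialField A (1 / 2)) u =
      (√(1 + diagonal u * green Q).det)⁻¹ := by
  have hu1 : ∀ x, 0 < 1 + u x := fun x => add_pos_of_pos_of_nonneg one_pos (hu x)
  have hd : ∀ x, 0 < (1 + u x)⁻¹ := fun x => inv_pos.2 (hu1 x)
  have hd1 : ∀ x, (1 + u x)⁻¹ ≤ 1 := fun x => inv_le_one_of_one_le₀ (le_add_of_nonneg_right (hu x))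
  obtain ⟨hs, hsum⟩ := hacc.hasSum_loopMeasure_sqrt_conj hQ hd hd1
  obtain ⟨hm, hmsum⟩ := hacc.hasSum_loopMeasure hQ
  have hpos := hacc.posDef_one_sub hQ
  have hpos' : 0 < (1 - Q + diagonal u).det :=
    (hpos.add_posSemidef (PosSemidef.diagonal hu)).det_pos
  have hdet : (1 + diagonal u * green Q).det = (1 - Q + diagonal u).det / (1 - Q).det := by
    rw [eq_div_iff hpos.det_pos.ne', ← det_mul, add_mul, one_mul, mul_assoc, green,
      nonsing_inv_mul _ hpos.det_pos.ne'.isUnit, mul_one]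
  have hsoup := (hasSum_soupWeight_mul_pow_localTime hm (1 / 2) hs).tsum_eq
  rw [hsum.tsum_eq, hmsum.tsum_eq, det_one_sub_sqrt_conj hu] at hsoup
  simp_rw [laplace_conv, laplace_gammaFieldLaw _ hu, trivialField, laplace_gammaFieldLaw _ hu,
    ← mul_assoc]
  rw [tsum_mul_right, hdet, ← exp_half_log_mul_rpow hpos.det_pos hpos'
    (Finset.prod_pos fun x (_ : x ∈ Finset.univ) => hd x),
    ← Real.finsetProd_rpow _ _ fun x _ => (hd x).le]
  simp only [NNReal.coe_natCast, Real.rpow_natCast]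
  rw [hsoup]
  simp

end Isomorphism

end LoopSoup

theorem mainTheorem1 {A : Type*} [Fintype A] [DecidableEq A] (Q : Matrix A A ℝ)
    (hsymm : Q.IsSymm) (hacc : LoopSoup.Acceptable Q) :
    IsUnit (1 - Q) ∧ (LoopSoup.green Q).PosDef ∧
    Summable (fun ω => |LoopSoup.loopMeasure Q ω|) ∧
    (∀ ℓ : LoopSoup.RootedLoop A →₀ ℕ, Multipliable fun ω =>
      LoopSoup.signedPoisson (((1 / 2 : ℝ≥0) : ℝ) * LoopSoup.loopMeasure Q ω) (ℓ ω)) ∧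
    Summable (fun ℓ => |LoopSoup.soupWeight Q (1 / 2) ℓ|) ∧
    ∀ {Ω : Type*} [MeasurableSpace Ω] (P : Measure Ω) [IsProbabilityMeasure P] (φ : Ω → A → ℝ),
      LoopSoup.IsGaussianFreeField P (LoopSoup.green Q) φ →
        (P.map fun ω x => φ ω x ^ 2 / 2).toSignedMeasure =
          LoopSoup.fullOccupationField Q (1 / 2) := by
  have hpos := hacc.posDef_one_sub hsymm
  have hG : (LoopSoup.green Q).PosDef := hpos.inv
  have hm := (hacc.hasSum_loopMeasure hsymm).1
  have hsoup := LoopSoup.summable_soupWeight hm (1 / 2)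
  refine ⟨hpos.isUnit, hG, hm, fun ℓ =>
    (LoopSoup.hasProd_signedPoisson (hm.of_abs.mul_left _) ℓ).multipliable, hsoup, ?_⟩
  intro Ω _ P _ φ hφ
  rw [LoopSoup.fullOccupationField, LoopSoup.occupationField,
    LoopSoup.signedConv_signedMixture hsoup.of_abs]
  have hnonneg : ∀ᵐ y ∂(P.map fun ω x => φ ω x ^ 2 / 2), 0 ≤ y := by
    rw [ae_map_iff (LoopSoup.aemeasurable_sq_div_two hφ.aemeasurable)
      isClosed_Ici.measurableSet]
    exact .of_forall fun ω x => by simp only [Pi.zero_apply]; positivity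
  refine LoopSoup.toSignedMeasure_eq_signedMixture hsoup.of_abs _ (fun ℓ => ?_) _ hnonneg
    fun u hu => ?_
  · exact LoopSoup.ae_conv_nonneg (LoopSoup.ae_gammaFieldLaw_nonneg _)
      (LoopSoup.ae_gammaFieldLaw_nonneg _)
  · rw [LoopSoup.laplace_map_sq_freeField hG.posSemidef hφ hu,
      hacc.tsum_soupWeight_mul_laplace hsymm hu]
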